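/- **Δ-convergence of proximal Picard iterates.** Let $(X,d)$ be a complete CAT(0) space, that is, a complete metric space in which every two distinct points are joined by a geodesic and which satisfies the CN inequality: for all $x,y,z,m\in X$ with $d(x,m)=d(y,m)=\frac12 d(x,y)$, $$d(z,m)^2\le \tfrac12 d(z,x)^2+\tfrac12 d(z,y)^2-\tfrac14 d(x,y)^2 .$$ Let $F:X\to(-\infty,\infty]$ be proper ($F(x)<\infty$ for some $x$), convex ($F\circ\gamma$ is convex for every geodesic $\gamma:[a,b]\to X$) and lower semicontinuous, and assume that $F$ has a minimizer, that is, a point $p\in X$ with $F(p)\le F(y)$ for all $y\in X$. Let $\mu>0$. Then for every $x\in X$ there is a unique point $J_\mu(x)\in X$ such that $$\mu F(J_\mu(x))+d(x,J_\mu(x))^2=\inf_{y\in X}\{\mu F(y)+d(x,y)^2\},$$ and for every $x\in X$ the sequence of Picard iterates $(J_\mu^n(x))_{n\ge0}$ of the resolvent $J_\mu$ so defined $\Delta$-converges to a minimizer of $F$. Here a bounded sequence $(x_n)$ in $X$ is said to $\Delta$-converge to $p\in X$ if, for every subsequence $(u_n)$ of $(x_n)$, the point $p$ is the unique minimizer over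 $X$ (the unique asymptotic center of $(u_n)$) of the function $y\mapsto\limsup_{n\to\infty} d(y,u_n)$. In particular, the sequence $(J_\mu^n(x))$ is bounded. -/

import Mathlib

open Set Filter Topology

/-- `γ`, restricted to `[a, b]`, is a geodesic path; only the values of `γ` on `[a, b]` matter. -/
def IsGeodesic {X : Type*} [MetricSpace X] (γ : ℝ → X) (a b : ℝ) : Prop :=
  ∀ s ∈ Icc a b, ∀ t ∈ Icc a b, dist (γ s) (γ t) = |s - t|

/-- Every two distinct points are joined by a geodesic. -/
def IsGeodesicSpace (X : Type*) [MetricSpace X] : Prop :=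
  ∀ x y : X, x ≠ y → ∃ (a b : ℝ) (γ : ℝ → X), a ≤ b ∧ IsGeodesic γ a b ∧ γ a = x ∧ γ b = y

/-- A CAT(0) space: a geodesic space satisfying the CN inequality of Bruhat and Tits. -/
structure IsCAT0 (X : Type*) [MetricSpace X] : Prop where
  geodesic : IsGeodesicSpace X
  cn : ∀ x y z m : X, dist x m = 1 / 2 * dist x y → dist y m = 1 / 2 * dist x y →
    dist z m ^ 2 ≤ 1 / 2 * dist z x ^ 2 + 1 / 2 * dist z y ^ 2 - 1 / 4 * dist x y ^ 2

/-- The effective domain of `F`. -/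
def effDomain {X : Type*} (F : X → EReal) : Set X := {x | F x < ⊤}

/-- `F : X → (-∞, ∞]` is proper: it never takes the value `-∞`, and its effective domain is
nonempty. -/
structure IsProperFun {X : Type*} (F : X → EReal) : Prop where
  ne_bot : ∀ x, F x ≠ ⊥
  dom_nonempty : (effDomain F).Nonempty

/-- `F` is convex along every geodesic. (In `EReal`, `0 * ⊤ = 0`, the usual convention.) -/
def IsGeodesicallyConvex {X : Type*} [MetricSpace X] (F : X → EReal) : Prop :=
  ∀ (a b : ℝ) (γ : ℝ → X), IsGeodesic γ a b →
    ∀ s ∈ Icc a b, ∀ t ∈ Icc a b, ∀ l ∈ Icc (0 : ℝ) 1,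
      F (γ ((1 - l) * s + l * t)) ≤ ((1 - l : ℝ) : EReal) * F (γ s) + (l : EReal) * F (γ t)

/-- The set of minimizers of `F`. -/
def minimizers {X : Type*} (F : X → EReal) : Set X := {x | ∀ y, F x ≤ F y}

/-- The Moreau–Yosida approximation `F^μ`. -/
noncomputable def moreauYosida {X : Type*} [MetricSpace X] (F : X → EReal) (μ : ℝ) (x : X) :
    EReal :=
  ⨅ y : X, ((μ : EReal) * F y + ((dist x y ^ 2 : ℝ) : EReal))

/-- `y` attains the infimum that defines `F^μ(x)`. -/
def AttainsMoreauYosida {X : Type*} [MetricSpace X] (F : X → EReal) (μ : ℝ) (x y : X) : Prop :=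
  moreauYosida F μ x = (μ : EReal) * F y + ((dist x y ^ 2 : ℝ) : EReal)

open Classical in
/-- The resolvent `J_μ` of `F`: `J_μ(x)` is the point attaining the infimum that defines `F^μ(x)`
(with the junk value `x` if there is none). -/
noncomputable def resolvent_J {X : Type*} [MetricSpace X] (F : X → EReal) (μ : ℝ) (x : X) : X :=
  if h : ∃ y, AttainsMoreauYosida F μ x y then h.choose else x

/-- `r(y, (u_n)) = limsup d(y, u_n)`; meaningful for bounded sequences. -/
noncomputable def asympRadiusAt {X : Type*} [MetricSpace X] (u : ℕ → X) (y : X) : ℝ :=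
  limsup (fun n => dist y (u n)) atTop

/-- The set of asymptotic centers of `u` (with respect to the whole space). -/
def asympCenters {X : Type*} [MetricSpace X] (u : ℕ → X) : Set X :=
  {c | ∀ y, asympRadiusAt u c ≤ asympRadiusAt u y}

/-- Δ-convergence: `u` is bounded and `p` is the unique asymptotic center of every subsequence. -/
def DeltaTendsto {X : Type*} [MetricSpace X] (u : ℕ → X) (p : X) : Prop :=
  Bornology.IsBounded (range u) ∧ ∀ φ : ℕ → ℕ, StrictMono φ → asympCenters (u ∘ φ) = {p}

/-! The CN inequality makes both `μ F + d(x, ·)²` and the squared asymptotic radius strongly convex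
at midpoints. Such a function `G` has a unique minimizer `y`, with quadratic growth `G y + d(y, z)²
≤ G z` (`MidpointStronglyConvexOn.add_sq_dist_le`, `MidpointStronglyConvexOn.exists_forall_le`).
This yields the resolvent and unique asymptotic centers.

For the iterates, growth tested at a minimizer `q` shows that `d(q, w n)` decreases and that `F (w
n)` tends to `min F`. Growth at the resolvent of an asymptotic center `c` then forces `c` to be a
minimizer (`mem_minimizers_of_mem_asympCenters`). Since distances to minimizers converge, radii at
minimizers are the same for all subsequences, so all centers coincide. -/

/-! ### Midpoints and strong convexity -/

theorem exists_midpoint_of_isCAT0 {X : Type*} [MetricSpace X] (hX : IsCAT0 X) {F : X → EReal}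
    (hF : IsGeodesicallyConvex F) (x y : X) :
    ∃ m : X, dist x m = 1 / 2 * dist x y ∧ dist y m = 1 / 2 * dist x y ∧
      F m ≤ ((1 / 2 : ℝ) : EReal) * F x + ((1 / 2 : ℝ) : EReal) * F y := by
  have key : ∃ (a b : ℝ) (γ : ℝ → X), a ≤ b ∧ IsGeodesic γ a b ∧ γ a = x ∧ γ b = y := by
    by_cases h : x = y
    · refine ⟨0, 0, fun _ => x, le_rfl, ?_, rfl, h⟩
      intro s hs t ht
      obtain rfl : s = 0 := le_antisymm hs.2 hs.1
      obtain rfl : t = 0 := le_antisymm ht.2 ht.1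
      simp
    · exact hX.geodesic x y h
  obtain ⟨a, b, γ, hab, hγ, rfl, rfl⟩ := key
  have ha : a ∈ Icc a b := left_mem_Icc.2 hab
  have hb : b ∈ Icc a b := right_mem_Icc.2 hab
  have hm : (1 - 1 / 2) * a + 1 / 2 * b ∈ Icc a b := ⟨by linarith, by linarith⟩
  have h1 : |a - b| = b - a := by rw [abs_of_nonpos (by linarith)]; ring
  refine ⟨γ ((1 - 1 / 2) * a + 1 / 2 * b), ?_, ?_, ?_⟩
  · rw [hγ a ha _ hm, hγ a ha b hb, h1, abs_of_nonpos (by linarith)]; ring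
  · rw [hγ b hb _ hm, hγ a ha b hb, h1, abs_of_nonneg (by linarith)]; ring
  · have := hF a b γ hγ a ha b hb (1 / 2) ⟨by norm_num, by norm_num⟩
    rwa [show (1 - 1 / 2 : ℝ) = 1 / 2 by norm_num] at this ⊢

/-- `G` is strongly convex at midpoints of pairs of points of `S`. -/
def MidpointStronglyConvexOn {X : Type*} [MetricSpace X] (S : Set X) (G : X → ℝ) : Prop :=
  ∀ x ∈ S, ∀ y ∈ S, ∃ m ∈ S, dist x m = 1 / 2 * dist x y ∧
    G m ≤ 1 / 2 * G x + 1 / 2 * G y - 1 / 4 * dist x y ^ 2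

/-- A growth constant `κ` applied at the midpoint improves to `(1 + κ) / 2`; iterating from `κ = 0`
gives `1` in the limit. -/
theorem MidpointStronglyConvexOn.add_sq_dist_le {X : Type*} [MetricSpace X] {S : Set X}
    {G : X → ℝ} (hG : MidpointStronglyConvexOn S G) {y : X} (hy : y ∈ S)
    (hmin : ∀ z ∈ S, G y ≤ G z) {z : X} (hz : z ∈ S) : G y + dist y z ^ 2 ≤ G z := by
  have step : ∀ k : ℕ, ∀ z ∈ S, G y + (1 - (1 / 2 : ℝ) ^ k) * dist y z ^ 2 ≤ G z := by
    intro k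
    induction k with
    | zero => intro z hz; simpa using hmin z hz
    | succ k ih =>
      intro z hz
      obtain ⟨m, hm, hd, hGm⟩ := hG y hy z hz
      have h := ih m hm
      rw [hd] at h
      rw [pow_succ]
      linarith
  have hlim : Tendsto (fun k : ℕ => G y + (1 - (1 / 2 : ℝ) ^ k) * dist y z ^ 2) atTop
      (𝓝 (G y + (1 - 0) * dist y z ^ 2)) :=
    (((tendsto_pow_atTop_nhds_zero_of_lt_one (by norm_num) (by norm_num)).const_sub 1).mul_const
      _).const_add _
  simpa using le_of_tendsto' hlim fun k => step k z hz

/-- A minimizing sequence is Cauchy, because `G` at midpoints is still at least the infimum. In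
`hclosed`, `S` need not be closed, which suits effective domains. -/
theorem MidpointStronglyConvexOn.exists_forall_le {X : Type*} [MetricSpace X] [CompleteSpace X]
    {S : Set X} {G : X → ℝ} (hG : MidpointStronglyConvexOn S G) (hS : S.Nonempty)
    (hbdd : BddBelow (G '' S))
    (hclosed : ∀ (v : ℕ → X) (y : X) (L : ℝ), (∀ n, v n ∈ S) → Tendsto v atTop (𝓝 y) →
      Tendsto (fun n => G (v n)) atTop (𝓝 L) → y ∈ S ∧ G y ≤ L) :
    ∃ y ∈ S, ∀ z ∈ S, G y ≤ G z := by
  set I := sInf (G '' S) with hI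
  have hle : ∀ z ∈ S, I ≤ G z := fun z hz => csInf_le hbdd ⟨z, hz, rfl⟩
  have hex : ∀ n : ℕ, ∃ z ∈ S, G z < I + 1 / ((n : ℝ) + 1) := by
    intro n
    obtain ⟨_, ⟨z, hz, rfl⟩, h⟩ := exists_lt_of_csInf_lt (hS.image G)
      (show sInf (G '' S) < I + 1 / ((n : ℝ) + 1) from lt_add_of_pos_right _ (by positivity))
    exact ⟨z, hz, h⟩
  choose v hvS hv using hex
  have hv' : ∀ N n : ℕ, N ≤ n → G (v n) ≤ I + 1 / ((N : ℝ) + 1) := fun N n h =>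
    (hv n).le.trans (by gcongr)
  have hlim := tendsto_one_div_add_atTop_nhds_zero_nat (𝕜 := ℝ)
  have hcauchy : CauchySeq v := by
    refine cauchySeq_of_le_tendsto_0 (fun N : ℕ => √(4 * (1 / ((N : ℝ) + 1)))) ?_ ?_
    · intro n k N hn hk
      obtain ⟨m, hm, -, hGm⟩ := hG _ (hvS n) _ (hvS k)
      apply Real.le_sqrt_of_sq_le
      linarith [hle m hm, hv' N n hn, hv' N k hk]
    · simpa using (hlim.const_mul 4).sqrt
  obtain ⟨y, hy⟩ := cauchySeq_tendsto_of_complete hcauchy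
  have hGv : Tendsto (fun n => G (v n)) atTop (𝓝 I) := by
    refine tendsto_of_tendsto_of_tendsto_of_le_of_le tendsto_const_nhds
      (h := fun n : ℕ => I + 1 / ((n : ℝ) + 1)) ?_ (fun n => hle _ (hvS n)) fun n => (hv n).le
    simpa using hlim.const_add I
  obtain ⟨hyS, hyI⟩ := hclosed v y I hvS hy hGv
  exact ⟨y, hyS, fun z hz => hyI.trans (hle z hz)⟩

/-! ### Asymptotic radii and centers of bounded sequences -/

section AsymptoticCenters

variable {X : Type*} [MetricSpace X] {u : ℕ → X}

theorem isBoundedUnder_dist (hu : Bornology.IsBounded (range u)) (y : X) :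
    IsBoundedUnder (· ≤ ·) atTop (fun n => dist y (u n)) := by
  obtain ⟨r, hr⟩ := (Metric.isBounded_iff_subset_closedBall y).1 hu
  refine isBoundedUnder_of ⟨r, fun n => ?_⟩
  have := hr ⟨n, rfl⟩
  rwa [Metric.mem_closedBall'] at this

theorem isCoboundedUnder_dist (u : ℕ → X) (y : X) :
    IsCoboundedUnder (· ≤ ·) atTop (fun n => dist y (u n)) :=
  (isBoundedUnder_of ⟨0, fun _ => dist_nonneg⟩ :
    IsBoundedUnder (· ≥ ·) atTop (fun n => dist y (u n))).isCoboundedUnder_le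

theorem asympRadiusAt_le {y : X} {r : ℝ} (h : ∀ᶠ n in atTop, dist y (u n) ≤ r) :
    asympRadiusAt u y ≤ r :=
  limsup_le_of_le (isCoboundedUnder_dist u y) h

theorem eventually_dist_lt_of_asympRadiusAt_lt (hu : Bornology.IsBounded (range u)) {y : X}
    {r : ℝ} (h : asympRadiusAt u y < r) : ∀ᶠ n in atTop, dist y (u n) < r :=
  eventually_lt_of_limsup_lt h (isBoundedUnder_dist hu y)

theorem asympRadiusAt_nonneg (hu : Bornology.IsBounded (range u)) (y : X) :
    0 ≤ asympRadiusAt u y := by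
  by_contra! h
  obtain ⟨n, hn⟩ := (eventually_dist_lt_of_asympRadiusAt_lt hu h).exists
  exact absurd hn (not_lt.2 dist_nonneg)

theorem asympRadiusAt_le_add_dist (hu : Bornology.IsBounded (range u)) (y z : X) :
    asympRadiusAt u y ≤ asympRadiusAt u z + dist y z := by
  refine le_of_forall_pos_le_add fun ε hε => asympRadiusAt_le ?_
  filter_upwards [eventually_dist_lt_of_asympRadiusAt_lt hu
    (lt_add_of_pos_right (asympRadiusAt u z) hε)] with n hn
  linarith [dist_triangle y z (u n)]

theorem continuous_asympRadiusAt (hu : Bornology.IsBounded (range u)) :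
    Continuous (asympRadiusAt u) :=
  (LipschitzWith.of_le_add (asympRadiusAt_le_add_dist hu)).continuous

theorem asympRadiusAt_sq_le (hu : Bornology.IsBounded (range u)) {x y z : X} {a b c : ℝ}
    (ha : 0 ≤ a) (hb : 0 ≤ b)
    (h : ∀ n, dist z (u n) ^ 2 ≤ a * dist x (u n) ^ 2 + b * dist y (u n) ^ 2 + c) :
    asympRadiusAt u z ^ 2 ≤ a * asympRadiusAt u x ^ 2 + b * asympRadiusAt u y ^ 2 + c := by
  have hε : ∀ ε > 0, asympRadiusAt u z ^ 2 ≤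
      a * (asympRadiusAt u x + ε) ^ 2 + b * (asympRadiusAt u y + ε) ^ 2 + c := by
    intro ε hε
    set R := a * (asympRadiusAt u x + ε) ^ 2 + b * (asympRadiusAt u y + ε) ^ 2 + c
    have hev : ∀ᶠ n in atTop, dist z (u n) ^ 2 ≤ R := by
      filter_upwards [eventually_dist_lt_of_asympRadiusAt_lt hu
          (lt_add_of_pos_right (asympRadiusAt u x) hε),
        eventually_dist_lt_of_asympRadiusAt_lt hu
          (lt_add_of_pos_right (asympRadiusAt u y) hε)] with n hx hy
      refine (h n).trans ?_
      simp only [R]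
      gcongr
    obtain ⟨n, hn⟩ := hev.exists
    have hR : 0 ≤ R := (sq_nonneg _).trans hn
    have hs : asympRadiusAt u z ≤ √R := asympRadiusAt_le (hev.mono fun n hn =>
      Real.le_sqrt_of_sq_le hn)
    calc asympRadiusAt u z ^ 2 ≤ √R ^ 2 := by
          have := asympRadiusAt_nonneg hu z
          gcongr
      _ = R := Real.sq_sqrt hR
  have hcont : Continuous fun ε : ℝ =>
      a * (asympRadiusAt u x + ε) ^ 2 + b * (asympRadiusAt u y + ε) ^ 2 + c := by fun_prop
  have hlim := (hcont.tendsto 0).mono_left (nhdsWithin_le_nhds (s := Ioi 0))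
  simp only [add_zero] at hlim
  exact ge_of_tendsto hlim (eventually_mem_nhdsWithin.mono hε)

theorem midpointStronglyConvexOn_asympRadiusAt_sq (hX : IsCAT0 X)
    (hu : Bornology.IsBounded (range u)) :
    MidpointStronglyConvexOn univ (fun y => asympRadiusAt u y ^ 2) := by
  intro x _ y _
  -- Only the midpoint is needed, so the zero function serves as `F`.
  obtain ⟨m, h1, h2, -⟩ := exists_midpoint_of_isCAT0 (F := fun _ => 0) hX
    (fun a b γ _ s _ t _ l _ => by simp) x y
  refine ⟨m, mem_univ _, h1, ?_⟩
  have := asympRadiusAt_sq_le hu (x := x) (y := y) (z := m) (a := 1 / 2) (b := 1 / 2)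
    (c := -(1 / 4 * dist x y ^ 2)) (by norm_num) (by norm_num) fun n => by
      have := hX.cn x y (u n) m h1 h2
      rw [dist_comm m, dist_comm x (u n), dist_comm y (u n)]
      linarith
  linarith

theorem exists_asympCenters_eq_singleton [CompleteSpace X] (hX : IsCAT0 X)
    (hu : Bornology.IsBounded (range u)) : ∃ c, asympCenters u = {c} := by
  have hG := midpointStronglyConvexOn_asympRadiusAt_sq hX hu
  obtain ⟨c, -, hc⟩ := hG.exists_forall_le ⟨u 0, mem_univ _⟩
    ⟨0, by rintro _ ⟨y, -, rfl⟩; positivity⟩ fun v y L _ hv hL =>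
      ⟨mem_univ _, (tendsto_nhds_unique
        ((((continuous_asympRadiusAt hu).pow 2).tendsto y).comp hv) hL).le⟩
  refine ⟨c, Set.ext fun z => ⟨fun hz => ?_, ?_⟩⟩
  · have h1 := hG.add_sq_dist_le (mem_univ c) hc (mem_univ z)
    have h2 : asympRadiusAt u z ^ 2 ≤ asympRadiusAt u c ^ 2 :=
      pow_le_pow_left₀ (asympRadiusAt_nonneg hu z) (hz c) 2
    have h3 : dist c z ^ 2 = 0 := le_antisymm (by linarith) (sq_nonneg _)
    exact (dist_eq_zero.1 (pow_eq_zero_iff two_ne_zero |>.1 h3)).symm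
  · rintro rfl y
    exact le_of_sq_le_sq (hc y (mem_univ y)) (asympRadiusAt_nonneg hu y)

theorem asympRadiusAt_eq_of_tendsto {y : X} {r : ℝ}
    (h : Tendsto (fun n => dist y (u n)) atTop (𝓝 r)) : asympRadiusAt u y = r :=
  h.limsup_eq

end AsymptoticCenters

/-! ### Resolvents and minimizers -/

section Resolvent

variable {X : Type*} {F : X → EReal} {μ : ℝ}

theorem IsProperFun.coe_toReal (hF : IsProperFun F) {y : X} (hy : y ∈ effDomain F) :
    ((F y).toReal : EReal) = F y :=
  EReal.coe_toReal (ne_of_lt hy) (hF.ne_bot y)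

theorem IsProperFun.toReal_le_toReal (hF : IsProperFun F) {y z : X} (hz : z ∈ effDomain F)
    (h : F y ≤ F z) : (F y).toReal ≤ (F z).toReal :=
  EReal.toReal_le_toReal h (hF.ne_bot y) (ne_of_lt hz)

theorem IsProperFun.minimizers_subset (hF : IsProperFun F) : minimizers F ⊆ effDomain F := by
  intro p hp
  obtain ⟨z, hz⟩ := hF.dom_nonempty
  exact lt_of_le_of_lt (hp z) hz

variable [MetricSpace X]

theorem IsProperFun.mul_add_sq_dist (hF : IsProperFun F) (x : X) {y : X}
    (hy : y ∈ effDomain F) : (μ : EReal) * F y + ((dist x y ^ 2 : ℝ) : EReal) =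
      ((μ * (F y).toReal + dist x y ^ 2 : ℝ) : EReal) := by
  rw [EReal.coe_add, EReal.coe_mul, hF.coe_toReal hy]

theorem mul_add_sq_dist_eq_top (hμ : 0 < μ) (x : X) {y : X} (hy : y ∉ effDomain F) :
    (μ : EReal) * F y + ((dist x y ^ 2 : ℝ) : EReal) = ⊤ := by
  have : F y = ⊤ := not_lt_top_iff.1 hy
  rw [this, EReal.coe_mul_top_of_pos hμ, EReal.top_add_coe]

/-- Points outside the nonempty domain have value `⊤`, so the problem reduces to real values on
`effDomain F`. -/
theorem attainsMoreauYosida_iff (hF : IsProperFun F) (hμ : 0 < μ) {x y : X} :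
    AttainsMoreauYosida F μ x y ↔ y ∈ effDomain F ∧ ∀ z ∈ effDomain F,
      μ * (F y).toReal + dist x y ^ 2 ≤ μ * (F z).toReal + dist x z ^ 2 := by
  have hiff : AttainsMoreauYosida F μ x y ↔ ∀ z,
      (μ : EReal) * F y + ((dist x y ^ 2 : ℝ) : EReal) ≤
        (μ : EReal) * F z + ((dist x z ^ 2 : ℝ) : EReal) := by
    unfold AttainsMoreauYosida moreauYosida
    exact ⟨fun h z => h ▸ iInf_le _ z, fun h => le_antisymm (iInf_le _ y) (le_iInf h)⟩
  rw [hiff]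
  constructor
  · intro h
    have hy : y ∈ effDomain F := by
      by_contra hy
      obtain ⟨z, hz⟩ := hF.dom_nonempty
      have := h z
      rw [mul_add_sq_dist_eq_top hμ x hy, hF.mul_add_sq_dist x hz] at this
      exact EReal.coe_ne_top _ (top_le_iff.1 this)
    refine ⟨hy, fun z hz => ?_⟩
    have := h z
    rwa [hF.mul_add_sq_dist x hy, hF.mul_add_sq_dist x hz, EReal.coe_le_coe_iff] at this
  · rintro ⟨hy, h⟩ z
    by_cases hz : z ∈ effDomain F
    · rw [hF.mul_add_sq_dist x hy, hF.mul_add_sq_dist x hz, EReal.coe_le_coe_iff]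
      exact h z hz
    · rw [mul_add_sq_dist_eq_top hμ x hz]
      exact le_top

theorem midpointStronglyConvexOn_moreauYosida (hX : IsCAT0 X) (hF : IsProperFun F)
    (hconvex : IsGeodesicallyConvex F) (hμ : 0 < μ) (x : X) :
    MidpointStronglyConvexOn (effDomain F) (fun y => μ * (F y).toReal + dist x y ^ 2) := by
  intro y hy z hz
  obtain ⟨m, h1, h2, hm⟩ := exists_midpoint_of_isCAT0 hX hconvex y z
  rw [← hF.coe_toReal hy, ← hF.coe_toReal hz, ← EReal.coe_mul, ← EReal.coe_mul,
    ← EReal.coe_add] at hm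
  have hmS : m ∈ effDomain F := lt_of_le_of_lt hm (EReal.coe_lt_top _)
  refine ⟨m, hmS, h1, ?_⟩
  rw [← hF.coe_toReal hmS, EReal.coe_le_coe_iff] at hm
  have hcn := hX.cn y z x m h1 h2
  have := mul_le_mul_of_nonneg_left hm hμ.le
  linarith

theorem exists_attainsMoreauYosida [CompleteSpace X] (hX : IsCAT0 X) (hF : IsProperFun F)
    (hconvex : IsGeodesicallyConvex F) (hlsc : LowerSemicontinuous F)
    (hmin : (minimizers F).Nonempty) (hμ : 0 < μ) (x : X) :
    ∃ y, AttainsMoreauYosida F μ x y := by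
  obtain ⟨p, hp⟩ := hmin
  obtain ⟨y, hy⟩ := (midpointStronglyConvexOn_moreauYosida hX hF hconvex hμ x).exists_forall_le
    hF.dom_nonempty ⟨μ * (F p).toReal, by
      rintro _ ⟨z, hz, rfl⟩
      have := mul_le_mul_of_nonneg_left (hF.toReal_le_toReal hz (hp z)) hμ.le
      have := sq_nonneg (dist x z)
      dsimp only
      linarith⟩ (by
    intro v y L hvS hv hL
    have hd : Tendsto (fun n => dist x (v n) ^ 2) atTop (𝓝 (dist x y ^ 2)) :=
      (tendsto_const_nhds.dist hv).pow 2
    have hf : Tendsto (fun n => (F (v n)).toReal) atTop (𝓝 ((L - dist x y ^ 2) / μ)) := by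
      refine ((hL.sub hd).div_const μ).congr fun n => ?_
      field_simp
      ring
    have hFy : F y ≤ (((L - dist x y ^ 2) / μ : ℝ) : EReal) := by
      by_contra! h
      obtain ⟨q, hq1, hq2⟩ := EReal.lt_iff_exists_real_btwn.1 h
      have h1 := hv.eventually (hlsc y q hq2)
      have h2 := hf.eventually (gt_mem_nhds (EReal.coe_lt_coe_iff.1 hq1))
      obtain ⟨n, hn1, hn2⟩ := (h1.and h2).exists
      rw [gt_iff_lt, ← hF.coe_toReal (hvS n), EReal.coe_lt_coe_iff] at hn1
      exact lt_asymm hn1 hn2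
    have hyS : y ∈ effDomain F := lt_of_le_of_lt hFy (EReal.coe_lt_top _)
    refine ⟨hyS, ?_⟩
    rw [← hF.coe_toReal hyS, EReal.coe_le_coe_iff, le_div_iff₀ hμ] at hFy
    linarith)
  exact ⟨y, (attainsMoreauYosida_iff hF hμ).2 hy⟩

theorem AttainsMoreauYosida.add_sq_dist_le (hX : IsCAT0 X) (hF : IsProperFun F)
    (hconvex : IsGeodesicallyConvex F) (hμ : 0 < μ) {x y z : X}
    (h : AttainsMoreauYosida F μ x y) (hz : z ∈ effDomain F) :
    μ * (F y).toReal + dist x y ^ 2 + dist y z ^ 2 ≤ μ * (F z).toReal + dist x z ^ 2 := by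
  obtain ⟨hy, hle⟩ := (attainsMoreauYosida_iff hF hμ).1 h
  exact (midpointStronglyConvexOn_moreauYosida hX hF hconvex hμ x).add_sq_dist_le hy hle hz

theorem AttainsMoreauYosida.unique (hX : IsCAT0 X) (hF : IsProperFun F)
    (hconvex : IsGeodesicallyConvex F) (hμ : 0 < μ) {x y z : X}
    (hy : AttainsMoreauYosida F μ x y) (hz : AttainsMoreauYosida F μ x z) : y = z := by
  obtain ⟨hyS, -⟩ := (attainsMoreauYosida_iff hF hμ).1 hy
  obtain ⟨hzS, hle⟩ := (attainsMoreauYosida_iff hF hμ).1 hz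
  have h1 := hy.add_sq_dist_le hX hF hconvex hμ hzS
  have h3 : dist y z ^ 2 = 0 := le_antisymm (by linarith [hle y hyS]) (sq_nonneg _)
  exact dist_eq_zero.1 (pow_eq_zero_iff two_ne_zero |>.1 h3)

/-- The growth constant is exactly `1`, so the two `d(x, z)²` terms cancel. -/
theorem AttainsMoreauYosida.mem_minimizers (hX : IsCAT0 X) (hF : IsProperFun F)
    (hconvex : IsGeodesicallyConvex F) (hμ : 0 < μ) {x : X}
    (h : AttainsMoreauYosida F μ x x) : x ∈ minimizers F := by
  intro z
  by_cases hz : z ∈ effDomain F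
  · have h1 := h.add_sq_dist_le hX hF hconvex hμ hz
    rw [← hF.coe_toReal hz, ← hF.coe_toReal ((attainsMoreauYosida_iff hF hμ).1 h).1,
      EReal.coe_le_coe_iff]
    refine le_of_mul_le_mul_left ?_ hμ
    simp only [dist_self] at h1
    linarith
  · rw [show F z = ⊤ from not_lt_top_iff.1 hz]
    exact le_top

theorem attainsMoreauYosida_resolvent_J {x : X} (h : ∃ y, AttainsMoreauYosida F μ x y) :
    AttainsMoreauYosida F μ x (resolvent_J F μ x) := by
  rw [resolvent_J, dif_pos h]
  exact h.choose_spec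

/-- An asymptotic center of a bounded minimizing sequence is a minimizer. -/
theorem mem_minimizers_of_mem_asympCenters [CompleteSpace X] (hX : IsCAT0 X)
    (hF : IsProperFun F) (hconvex : IsGeodesicallyConvex F) (hlsc : LowerSemicontinuous F)
    (hμ : 0 < μ) {p : X} (hp : p ∈ minimizers F) {u : ℕ → X}
    (hu : Bornology.IsBounded (range u)) (huS : ∀ᶠ n in atTop, u n ∈ effDomain F)
    (hlim : Tendsto (fun n => (F (u n)).toReal) atTop (𝓝 (F p).toReal)) {c : X}
    (hc : c ∈ asympCenters u) : c ∈ minimizers F := by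
  obtain ⟨y, hy⟩ := exists_attainsMoreauYosida hX hF hconvex hlsc ⟨p, hp⟩ hμ c
  suffices h : c = y by
    subst h
    exact hy.mem_minimizers hX hF hconvex hμ
  by_contra hne
  have hpos : 0 < dist c y ^ 2 := pow_pos (dist_pos.2 hne) 2
  obtain ⟨hyS, -⟩ := (attainsMoreauYosida_iff hF hμ).1 hy
  have hpy := mul_le_mul_of_nonneg_left (hF.toReal_le_toReal hyS (hp y)) hμ.le
  -- Half of `d(c, y)²` absorbs the error `μ (F (u n) - F p)`. The point `y` is then uniformly
  -- closer to the tail than the center `c`.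
  have hev : ∀ᶠ n in atTop, dist y (u n) ^ 2 + dist c y ^ 2 / 2 ≤ dist c (u n) ^ 2 := by
    have hlt := (hlim.const_mul μ).eventually
      (gt_mem_nhds (show μ * (F p).toReal < μ * (F p).toReal + dist c y ^ 2 / 2 by linarith))
    filter_upwards [huS, hlt] with n hn hn'
    have := hy.add_sq_dist_le hX hF hconvex hμ hn
    linarith
  set r := asympRadiusAt u c with hr
  have hcy : r ≤ asympRadiusAt u y := hc y
  have hr0 : 0 ≤ r := asympRadiusAt_nonneg hu c
  have hbound : ∀ ε > 0, r ^ 2 + dist c y ^ 2 / 2 ≤ (r + ε) ^ 2 := by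
    intro ε hε
    have hev' : ∀ᶠ n in atTop, dist y (u n) ≤ √((r + ε) ^ 2 - dist c y ^ 2 / 2) := by
      filter_upwards [hev, eventually_dist_lt_of_asympRadiusAt_lt hu
        (lt_add_of_pos_right (asympRadiusAt u c) hε)] with n h1 h2
      apply Real.le_sqrt_of_sq_le
      have : dist c (u n) ^ 2 ≤ (r + ε) ^ 2 := by gcongr
      linarith
    have hrle := hcy.trans (asympRadiusAt_le hev')
    rcases le_or_gt 0 ((r + ε) ^ 2 - dist c y ^ 2 / 2) with h | h
    · have := (Real.le_sqrt hr0 h).1 hrle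
      linarith
    -- A negative radicand would contradict `hev`.
    · obtain ⟨n, h1, h2⟩ := (hev.and (eventually_dist_lt_of_asympRadiusAt_lt hu
        (lt_add_of_pos_right (asympRadiusAt u c) hε))).exists
      have : dist c (u n) ^ 2 ≤ (r + ε) ^ 2 := by gcongr
      linarith [sq_nonneg (dist y (u n))]
  have hcont : Continuous fun ε : ℝ => (r + ε) ^ 2 := by fun_prop
  have hl := (hcont.tendsto 0).mono_left (nhdsWithin_le_nhds (s := Ioi 0))
  simp only [add_zero] at hl
  have := ge_of_tendsto hl (eventually_mem_nhdsWithin.mono hbound)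
  linarith

end Resolvent

/-! ### Convergence of the iterates -/

theorem corollary6p6 {X : Type*} [MetricSpace X] [CompleteSpace X] (hX : IsCAT0 X)
    (F : X → EReal) (hproper : IsProperFun F) (hconvex : IsGeodesicallyConvex F)
    (hlsc : LowerSemicontinuous F) (hmin : (minimizers F).Nonempty) (μ : ℝ) (hμ : 0 < μ) :
    (∀ x : X, ∃! y : X, AttainsMoreauYosida F μ x y) ∧
      ∀ x : X, ∃ p ∈ minimizers F, DeltaTendsto (fun n : ℕ => (resolvent_J F μ)^[n] x) p := by
  have hex := exists_attainsMoreauYosida hX hproper hconvex hlsc hmin hμ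
  refine ⟨fun x => ?_, fun x => ?_⟩
  · obtain ⟨y, hy⟩ := hex x
    exact ⟨y, hy, fun z hz => hz.unique hX hproper hconvex hμ hy⟩
  set w : ℕ → X := fun n => (resolvent_J F μ)^[n] x with hw
  have hstep : ∀ n, AttainsMoreauYosida F μ (w n) (w (n + 1)) := by
    intro n
    simp only [hw, Function.iterate_succ_apply']
    exact attainsMoreauYosida_resolvent_J (hex _)
  -- The starting point `w 0 = x` may have `F x = ⊤`, hence the shift by one here and below.
  have hS : ∀ n, w (n + 1) ∈ effDomain F := fun n =>
    ((attainsMoreauYosida_iff hproper hμ).1 (hstep n)).1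
  have hfejer : ∀ q ∈ minimizers F, ∀ n,
      μ * ((F (w (n + 1))).toReal - (F q).toReal) + dist q (w (n + 1)) ^ 2 ≤
        dist q (w n) ^ 2 := by
    intro q hq n
    have := (hstep n).add_sq_dist_le hX hproper hconvex hμ (hproper.minimizers_subset hq)
    rw [dist_comm q, dist_comm q]
    linarith [sq_nonneg (dist (w n) (w (n + 1)))]
  have hanti : ∀ q ∈ minimizers F, Antitone fun n => dist q (w n) := by
    intro q hq
    refine antitone_nat_of_succ_le fun n => le_of_sq_le_sq ?_ dist_nonneg
    have := mul_nonneg hμ.le (sub_nonneg.2 (hproper.toReal_le_toReal (hS n) (hq (w (n + 1)))))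
    linarith [hfejer q hq n]
  have hconv : ∀ q ∈ minimizers F, ∃ r, Tendsto (fun n => dist q (w n)) atTop (𝓝 r) :=
    fun q hq => ⟨_, tendsto_atTop_ciInf (hanti q hq)
      ⟨0, by rintro _ ⟨n, rfl⟩; exact dist_nonneg⟩⟩
  obtain ⟨q, hq⟩ := hmin
  have hbdd : Bornology.IsBounded (range w) := by
    refine (Metric.isBounded_iff_subset_closedBall q).2 ⟨dist q (w 0), ?_⟩
    rintro _ ⟨n, rfl⟩
    rw [Metric.mem_closedBall']
    exact hanti q hq (Nat.zero_le n)
  have hvals : Tendsto (fun n => (F (w n)).toReal) atTop (𝓝 (F q).toReal) := by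
    rw [← tendsto_add_atTop_iff_nat 1]
    obtain ⟨r, hr⟩ := hconv q hq
    have hdiff : Tendsto (fun n => (F q).toReal +
        (dist q (w n) ^ 2 - dist q (w (n + 1)) ^ 2) / μ) atTop (𝓝 (F q).toReal) := by
      simpa using ((((hr.pow 2).sub (((tendsto_add_atTop_iff_nat 1).2 hr).pow 2)).div_const
        μ).const_add (F q).toReal)
    -- By `hfejer`, the excess over the minimum is at most a difference of consecutive terms of a
    -- convergent sequence, divided by `μ`.
    refine tendsto_of_tendsto_of_tendsto_of_le_of_le tendsto_const_nhds hdiff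
      (fun n => hproper.toReal_le_toReal (hS n) (hq _)) fun n => ?_
    have : (F (w (n + 1))).toReal - (F q).toReal ≤
        (dist q (w n) ^ 2 - dist q (w (n + 1)) ^ 2) / μ := by
      rw [le_div_iff₀ hμ]
      linarith [hfejer q hq n]
    dsimp only
    linarith
  have hcenter : ∀ φ : ℕ → ℕ, StrictMono φ →
      ∃ c ∈ minimizers F, asympCenters (w ∘ φ) = {c} := by
    intro φ hφ
    have hb : Bornology.IsBounded (range (w ∘ φ)) := hbdd.subset (range_comp_subset_range φ w)
    obtain ⟨c, hc⟩ := exists_asympCenters_eq_singleton hX hb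
    refine ⟨c, ?_, hc⟩
    refine mem_minimizers_of_mem_asympCenters hX hproper hconvex hlsc hμ hq hb ?_
      (hvals.comp hφ.tendsto_atTop) (hc ▸ mem_singleton c)
    filter_upwards [eventually_ge_atTop 1] with n hn
    obtain ⟨k, hk⟩ := Nat.exists_eq_add_of_le' (hn.trans (hφ.id_le n))
    simp only [Function.comp_apply, hk]
    exact hS k
  obtain ⟨p, hp, hpc⟩ := hcenter id strictMono_id
  refine ⟨p, hp, hbdd, fun φ hφ => ?_⟩
  obtain ⟨c, hc, hcc⟩ := hcenter φ hφ
  suffices p ∈ asympCenters (w ∘ φ) by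
    rw [hcc] at this ⊢
    rw [mem_singleton_iff.1 this]
  have hcmem : c ∈ asympCenters (w ∘ φ) := hcc ▸ mem_singleton c
  have hpmem : p ∈ asympCenters (w ∘ id) := hpc ▸ mem_singleton p
  have hsub : ∀ q ∈ minimizers F, asympRadiusAt (w ∘ φ) q = asympRadiusAt (w ∘ id) q := by
    intro q hq
    obtain ⟨r, hr⟩ := hconv q hq
    rw [asympRadiusAt_eq_of_tendsto (u := w ∘ φ) (hr.comp hφ.tendsto_atTop),
      asympRadiusAt_eq_of_tendsto (u := w ∘ id) hr]
  -- Both `p` and `c` are minimizers, so `hsub` transfers the optimality of `p` for the full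
  -- sequence to the subsequence.
  intro y
  calc asympRadiusAt (w ∘ φ) p = asympRadiusAt (w ∘ id) p := hsub p hp
    _ ≤ asympRadiusAt (w ∘ id) c := hpmem c
    _ = asympRadiusAt (w ∘ φ) c := (hsub c hc).symm
    _ ≤ asympRadiusAt (w ∘ φ) y := hcmem y
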